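/- Let $(M,J)$ be a complex manifold (finite-dimensional, without boundary) and let $\Omega$ be a symplectic form on $M$ taming $J$, i.e. $\Omega(JX,X)>0$ for every nonzero tangent vector $X$. Consider the tamed almost generalized Kähler structure induced by the Hermitian-symplectic pair $(\Omega,J)$, that is, the almost bihermitian data $$J_+=J,\qquad J_-=-\Omega^{-1}J^*\Omega,\qquad g=\tfrac12\,\Omega(J_++J_-),$$ where $\Omega$ is viewed as the map $X\mapsto\Omega(X,\cdot)$ and $J^*\alpha=\alpha\circ J$, so that $g(X,Y)=\tfrac12\big(\Omega(J_+X,Y)+\Omega(J_-X,Y)\big)$ is a Riemannian metric. Let $Q=[J_+,J_-]=J_+J_--J_-J_+$, let $S(X,Y)=g(QX,Y)$, let $\tilde Q$ be the bivector field corresponding to the $2$-form $S$ under the isomorphism $TM\cong T^*M$ given by $g$, and let $\tilde Q^{(2,0)}$ be its $(2,0)$-part with respect to $J_+$. Let $$N_-(X,Y)=[X,Y]-[J_-X,J_-Y]+J_-[J_-X,Y]+J_-[X,J_-Y]$$ be the Nijenhuis tensor of $J_-$ and put $\psi(X,Y,Z)=\Omega(X,N_-(Y,Z))$. Let $\psi^{(3,0)}$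 be the $(3,0)$-part with respect to $J_+$ of the (not necessarily totally skew) $3$-tensor $\psi$, i.e. the complex trilinear extension of $\psi$ evaluated on the $(1,0)$-parts $\tfrac12(X-iJ_+X)$, $\tfrac12(Y-iJ_+Y)$, $\tfrac12(Z-iJ_+Z)$. Then $\tilde Q^{(2,0)}$ is holomorphic on the complex manifold $(M,J_+)$ (its coefficients in holomorphic coordinates are holomorphic functions) if and only if $\psi^{(3,0)}=0$. -/

import Mathlib

open Set VectorField
open scoped Manifold ContDiff

noncomputable section

namespace TamedGK

/-- A complex manifold is in particular a smooth real manifold, with the same charts. -/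
instance isManifold_real (E M : Type*) [NormedAddCommGroup E] [NormedSpace ℂ E]
    [TopologicalSpace M] [ChartedSpace E M] [IsManifold 𝓘(ℂ, E) ω M] :
    IsManifold 𝓘(ℝ, E) ∞ M := by
  refine isManifold_of_contDiffOn 𝓘(ℝ, E) ∞ M fun e e' he he' => ?_
  have h : ContDiffOn ℂ ω (𝓘(ℂ, E) ∘ (e.symm ≫ₕ e') ∘ 𝓘(ℂ, E).symm)
      (𝓘(ℂ, E).symm ⁻¹' (e.symm ≫ₕ e').source ∩ range 𝓘(ℂ, E)) :=
    ((contDiffGroupoid ω 𝓘(ℂ, E)).compatible he he').1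
  exact (h.restrict_scalars ℝ).of_le le_top

variable {E M : Type*} [NormedAddCommGroup E] [NormedSpace ℂ E]
  [TopologicalSpace M] [ChartedSpace E M]

/-- The real tangent space of the complex manifold `M` at `x`. -/
abbrev T (E : Type*) {M : Type*} [NormedAddCommGroup E] [NormedSpace ℂ E]
    [TopologicalSpace M] [ChartedSpace E M] (x : M) : Type _ :=
  TangentSpace 𝓘(ℝ, E) x

/-! ### Vector fields and tensors -/

/-- Not necessarily continuous (real) vector fields. -/
abbrev VField (E M : Type*) [NormedAddCommGroup E] [NormedSpace ℂ E]
    [TopologicalSpace M] [ChartedSpace E M] : Type _ :=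
  ∀ x : M, T E x

/-- `X` is a smooth vector field on `U`. -/
def SmoothOn [IsManifold 𝓘(ℂ, E) ω M] (X : VField E M) (U : Set M) : Prop :=
  ContMDiffOn 𝓘(ℝ, E) 𝓘(ℝ, E).tangent ∞
    (fun x => (⟨x, X x⟩ : TangentBundle 𝓘(ℝ, E) M)) U

/-- Fields of endomorphisms of the tangent bundle. -/
abbrev EndField (E M : Type*) [NormedAddCommGroup E] [NormedSpace ℂ E]
    [TopologicalSpace M] [ChartedSpace E M] : Type _ :=
  ∀ x : M, T E x →L[ℝ] T E x

/-- Fields of real bilinear forms on the tangent bundle. At each point such a form `B` is the map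
`X ↦ B(X, ·)` from the tangent to the cotangent space. -/
abbrev BilinField (E M : Type*) [NormedAddCommGroup E] [NormedSpace ℂ E]
    [TopologicalSpace M] [ChartedSpace E M] : Type _ :=
  ∀ x : M, T E x →L[ℝ] T E x →L[ℝ] ℝ

/-- The complex structure `J` of the complex manifold `M`: the tangent space at `x` is identified
with the complex vector space `E` by the derivative of a holomorphic chart, and `J` is
multiplication by `i`. -/
def complexStructure (E M : Type*) [NormedAddCommGroup E] [NormedSpace ℂ E]
    [TopologicalSpace M] [ChartedSpace E M] : EndField E M :=
  fun _ => (Complex.I • ContinuousLinearMap.id ℝ E : E →L[ℝ] E)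

/-- The derivative `Z f` of a real function along a vector field. -/
def deriv (Z : VField E M) (f : M → ℝ) (x : M) : ℝ :=
  (mfderiv 𝓘(ℝ, E) 𝓘(ℝ, ℝ) f x : T E x →L[ℝ] ℝ) (Z x)

/-- The Lie bracket of vector fields. -/
def bracket (X Y : VField E M) : VField E M := mlieBracket 𝓘(ℝ, E) X Y

/-- The value `(dΩ)(X, Y, Z)` of the exterior derivative of a 2-form on vector fields. -/
def extDeriv₂ (Ω : BilinField E M) (X Y Z : VField E M) (x : M) : ℝ :=
  deriv X (fun p => Ω p (Y p) (Z p)) x + deriv Y (fun p => Ω p (Z p) (X p)) x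
    + deriv Z (fun p => Ω p (X p) (Y p)) x
    - Ω x (bracket X Y x) (Z x) - Ω x (bracket Y Z x) (X x) - Ω x (bracket Z X x) (Y x)

/-- `Ω` is a symplectic form on `M`. -/
structure IsSymplectic [IsManifold 𝓘(ℂ, E) ω M] (Ω : BilinField E M) : Prop where
  smooth : ContMDiff 𝓘(ℝ, E) (𝓘(ℝ, E).prod 𝓘(ℝ, E →L[ℝ] E →L[ℝ] ℝ)) ∞
    (fun x => Bundle.TotalSpace.mk' (E →L[ℝ] E →L[ℝ] ℝ)
      (E := fun x : M => (T E x →L[ℝ] T E x →L[ℝ] ℝ)) x (Ω x))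
  skew : ∀ (x : M) (v w : T E x), Ω x v w = -Ω x w v
  nondegenerate : ∀ (x : M) (v : T E x), (∀ w : T E x, Ω x v w = 0) → v = 0
  closed : ∀ (U : Set M), IsOpen U → ∀ X Y Z : VField E M,
    SmoothOn X U → SmoothOn Y U → SmoothOn Z U → ∀ x ∈ U, extDeriv₂ Ω X Y Z x = 0

/-- `Ω` tames `J`: `Ω(J v, v) > 0` for every nonzero tangent vector `v`. -/
def Tames (Ω : BilinField E M) (J : EndField E M) : Prop :=
  ∀ (x : M) (v : T E x), v ≠ 0 → 0 < Ω x (J x v) v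

/-- The Nijenhuis tensor `[X, Y] - [AX, AY] + A[AX, Y] + A[X, AY]` of an endomorphism field `A`. -/
def nijenhuis (A : EndField E M) (X Y : VField E M) : VField E M := fun x =>
  bracket X Y x - bracket (fun p => A p (X p)) (fun p => A p (Y p)) x
    + A x (bracket (fun p => A p (X p)) Y x) + A x (bracket X (fun p => A p (Y p)) x)

/-! ### The almost bihermitian structure induced by `Ω` and `J` -/

/-- `J₊ = J`. -/
abbrev Jplus (E M : Type*) [NormedAddCommGroup E] [NormedSpace ℂ E]
    [TopologicalSpace M] [ChartedSpace E M] : EndField E M :=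
  complexStructure E M

/-- `J₋ = -Ω⁻¹ J* Ω`, where `J* α = α ∘ J` on covectors. -/
def Jminus (Ω : BilinField E M) : EndField E M := fun x =>
  -((Ω x).inverse ∘L ContinuousLinearMap.precomp ℝ (Jplus E M x) ∘L Ω x)

/-- The Riemannian metric `g = ½ Ω (J₊ + J₋)`, that is
`g(X, Y) = ½ (Ω(J₊ X, Y) + Ω(J₋ X, Y))`. -/
def metric (Ω : BilinField E M) : BilinField E M := fun x =>
  (1 / 2 : ℝ) • (Ω x ∘L (Jplus E M x + Jminus Ω x))

/-- The commutator `Q = [J₊, J₋]`. -/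
def Q (Ω : BilinField E M) : EndField E M := fun x =>
  Jplus E M x ∘L Jminus Ω x - Jminus Ω x ∘L Jplus E M x

/-- The 2-form `S(X, Y) = g(Q X, Y)`. -/
def S (Ω : BilinField E M) : BilinField E M := fun x => metric Ω x ∘L Q Ω x

/-- The vector metrically dual to a covector. -/
def dualVector (Ω : BilinField E M) (x : M) (α : T E x →L[ℝ] ℝ) : T E x :=
  (metric Ω x).inverse α

/-- The bivector `Q̃` corresponding to the 2-form `S` under the isomorphism between tangent and
cotangent spaces given by `g`, as a bilinear form on covectors. -/
def Qtilde (Ω : BilinField E M) (x : M) (α β : T E x →L[ℝ] ℝ) : ℝ :=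
  S Ω x (dualVector Ω x α) (dualVector Ω x β)

/-! ### Types with respect to `J₊` -/

/-- Complex valued covectors. -/
abbrev CCovector (E : Type*) {M : Type*} [NormedAddCommGroup E] [NormedSpace ℂ E]
    [TopologicalSpace M] [ChartedSpace E M] (x : M) : Type _ :=
  T E x →L[ℝ] ℂ

/-- The complex bilinear extension of a bilinear form on real covectors. -/
def complexify {x : M} (b : (T E x →L[ℝ] ℝ) → (T E x →L[ℝ] ℝ) → ℝ) (α β : CCovector E x) : ℂ :=
  ((b (Complex.reCLM ∘L α) (Complex.reCLM ∘L β) - b (Complex.imCLM ∘L α) (Complex.imCLM ∘L β) :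
      ℝ) : ℂ)
    + Complex.I * ((b (Complex.reCLM ∘L α) (Complex.imCLM ∘L β)
        + b (Complex.imCLM ∘L α) (Complex.reCLM ∘L β) : ℝ) : ℂ)

/-- The `(1,0)`-part `½ (α - i α ∘ J₊)` of a complex covector. -/
def part10 {x : M} (α : CCovector E x) : CCovector E x :=
  (1 / 2 : ℂ) • (α - Complex.I • (α ∘L Jplus E M x))

/-- The `(2,0)`-part with respect to `J₊` of the bivector `Q̃`, evaluated on complex covectors. -/
def Qtilde20 (Ω : BilinField E M) (x : M) (α β : CCovector E x) : ℂ :=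
  complexify (Qtilde Ω x) (part10 α) (part10 β)

/-- The differential of a complex valued function. -/
def differential (f : M → ℂ) (x : M) : CCovector E x :=
  (mfderiv 𝓘(ℝ, E) 𝓘(ℝ, ℂ) f x : T E x →L[ℝ] ℂ)

/-- A bivector field `σ` of type `(2,0)` is holomorphic: its coefficients `σ(dzᵢ, dzⱼ)` in every
holomorphic chart of `M` are holomorphic functions. The coordinates `zᵢ` are the compositions of
the chart with complex linear functionals on the model space. -/
def IsHolomorphicBivector (σ : ∀ x : M, CCovector E x → CCovector E x → ℂ) : Prop :=
  ∀ φ ∈ atlas E M, ∀ l m : E →L[ℂ] ℂ,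
    MDifferentiableOn 𝓘(ℂ, E) 𝓘(ℂ, ℂ)
      (fun x => σ x (differential (fun p => l (φ p)) x) (differential (fun p => m (φ p)) x))
      φ.source

/-- `ψ(X, Y, Z) = Ω(X, N₋(Y, Z))`, where `N₋` is the Nijenhuis tensor of `J₋`. -/
def psi (Ω : BilinField E M) (X Y Z : VField E M) (x : M) : ℝ :=
  Ω x (X x) (nijenhuis (Jminus Ω) Y Z x)

/-- The vector field `J₊ X`. -/
def JF (X : VField E M) : VField E M := fun x => Jplus E M x (X x)

/-- The `(3,0)`-part of `ψ` with respect to `J₊`: the value of the complex trilinear extension of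
`ψ` on the `(1,0)`-parts `½ (X - i J₊ X)`, `½ (Y - i J₊ Y)`, `½ (Z - i J₊ Z)`. -/
def psi30 (Ω : BilinField E M) (X Y Z : VField E M) (x : M) : ℂ :=
  (1 / 8 : ℂ) *
    (((psi Ω X Y Z x - psi Ω (JF X) (JF Y) Z x - psi Ω (JF X) Y (JF Z) x
        - psi Ω X (JF Y) (JF Z) x : ℝ) : ℂ)
      + Complex.I * ((psi Ω (JF X) (JF Y) (JF Z) x - psi Ω (JF X) Y Z x - psi Ω X (JF Y) Z x
        - psi Ω X Y (JF Z) x : ℝ) : ℂ))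

end TamedGK

end

/-! Write `J` for `J₊`, `A` for `J₋`. In a holomorphic chart `J` is constant, and both sides of the
equivalence reduce to the vanishing of one trilinear form `t` (`torsionForm`), built from the first
derivatives of `Ω` in the directions `x` and `J x`.

Torsion side. Differentiating `Ω(A y, z) = -Ω(y, J z)` expresses the derivative of `A` through that
of `Ω`, and `dΩ = 0` then gives `Ω(x, N₋(y, z)) = t(x, y, z)` (`form_flatNijenhuis`). Moreover `t(x,
A y, z) = t(J x, y, z) = t(x, y, A z)`, so, up to a constant factor, the real part of `ψ^{(3,0)}` is
`t(x, y - A J y, z - A J z)`. Taming makes `1 - A J` invertible, hence `ψ^{(3,0)} = 0` exactly when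
`t = 0` (`torsionForm_eq_zero_iff`).

Bivector side. The factorization `[J, A] = (J - A)(J + A)` cancels the metric and gives
`Q̃^{(2,0)}(α, β) = 4 β(J u - A u)` for `α`, `β` of type `(1,0)`, where `Ω(u, ·) = Re α`
(`Qtilde20_apply`). For holomorphic differentials, the failure of `β(J u - A u)` to have a complex
linear derivative is `-t(v, u, w) - i t(J v, u, w)`, with `Ω(w, ·) = Re β` (`hasFDerivAt_bracket`).
Such `u` and `w` fill the tangent space (`exists_hamiltonian_eq`), so holomorphy also means `t = 0`.
-/

noncomputable section

namespace TamedGK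

open Filter Topology

/-! ### Calculus at a point of a vector space with constant `J`. -/

section Flat

variable {F : Type*} [NormedAddCommGroup F] [NormedSpace ℝ F]

/-- A differentiable family `η` of skew bilinear forms together with endomorphisms `A`, `J` such
that `η(A y, z) = -η(y, J z)` and `J² = -1`, where `η` is closed, nondegenerate and taming `J` at
`e₀`. -/
structure IsLocalPair (η : F → F →L[ℝ] F →L[ℝ] ℝ) (A : F → F →L[ℝ] F) (J : F →L[ℝ] F) (e₀ : F) :
    Prop where
  diff_form : DifferentiableAt ℝ η e₀
  diff_end : DifferentiableAt ℝ A e₀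
  skew : ∀ᶠ e in 𝓝 e₀, ∀ y z, η e y z = -η e z y
  adjoint : ∀ᶠ e in 𝓝 e₀, ∀ y z, η e (A e y) z = -η e y (J z)
  sq : ∀ v, J (J v) = -v
  nondegenerate : ∀ v, (∀ w, η e₀ v w = 0) → v = 0
  closed : ∀ x y z, fderiv ℝ η e₀ x y z + fderiv ℝ η e₀ y z x + fderiv ℝ η e₀ z x y = 0
  tames : ∀ v, v ≠ 0 → 0 < η e₀ (J v) v

/-- The trilinear form `-Re (∂ₛ η)(y - i A y, z - i A z)`, where `∂ₛ η` is the derivative of `η` at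
`e₀` in the direction `s = x - i J x`. -/
def torsionForm (η : F → F →L[ℝ] F →L[ℝ] ℝ) (A : F → F →L[ℝ] F) (J : F →L[ℝ] F) (e₀ x y z : F) :
    ℝ :=
  fderiv ℝ η e₀ x (A e₀ y) (A e₀ z) - fderiv ℝ η e₀ x y z + fderiv ℝ η e₀ (J x) (A e₀ y) z
    + fderiv ℝ η e₀ (J x) y (A e₀ z)

/-- The Nijenhuis expression for vector fields on a vector space. -/
def flatNijenhuis (A : F → F →L[ℝ] F) (Y Z : F → F) (e : F) : F :=
  lieBracket ℝ Y Z e - lieBracket ℝ (fun p => A p (Y p)) (fun p => A p (Z p)) e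
    + A e (lieBracket ℝ (fun p => A p (Y p)) Z e) + A e (lieBracket ℝ Y (fun p => A p (Z p)) e)

namespace IsLocalPair

variable {η : F → F →L[ℝ] F →L[ℝ] ℝ} {A : F → F →L[ℝ] F} {J : F →L[ℝ] F} {e₀ : F}

lemma skew_self (h : IsLocalPair η A J e₀) (y z : F) : η e₀ y z = -η e₀ z y :=
  h.skew.self_of_nhds y z

lemma adjoint_self (h : IsLocalPair η A J e₀) (y z : F) : η e₀ (A e₀ y) z = -η e₀ y (J z) :=
  h.adjoint.self_of_nhds y z

lemma adjoint_right (h : IsLocalPair η A J e₀) (y z : F) : η e₀ y (A e₀ z) = -η e₀ (J y) z := by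
  rw [h.skew_self, h.adjoint_self, h.skew_self z, neg_neg]

/-- `A` is minus the `η`-adjoint of `J`, so its square is the adjoint of `J² = -1`. -/
lemma sq_end (h : IsLocalPair η A J e₀) (y : F) : A e₀ (A e₀ y) = -y := by
  rw [← sub_eq_zero]
  refine h.nondegenerate _ fun z => ?_
  rw [map_sub, sub_apply, h.adjoint_self, h.adjoint_self, h.sq]
  simp

lemma fderiv_apply₂ (h : IsLocalPair η A J e₀) (v y z : F) :
    fderiv ℝ (fun e => η e y z) e₀ v = fderiv ℝ η e₀ v y z := by
  have h1 := (h.diff_form.hasFDerivAt.clm_apply (hasFDerivAt_const y e₀)).clm_apply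
    (hasFDerivAt_const z e₀)
  simp [h1.fderiv]

lemma fderiv_skew (h : IsLocalPair η A J e₀) (v y z : F) :
    fderiv ℝ η e₀ v y z = -fderiv ℝ η e₀ v z y := by
  have h1 : (fun e => η e y z) =ᶠ[𝓝 e₀] fun e => -η e z y := h.skew.mono fun e he => he y z
  rw [← h.fderiv_apply₂, ← h.fderiv_apply₂, h1.fderiv_eq, fderiv_fun_neg]
  rfl

lemma fderiv_adjoint (h : IsLocalPair η A J e₀) (v y z : F) :
    η e₀ (fderiv ℝ A e₀ v y) z
      = -fderiv ℝ η e₀ v y (J z) - fderiv ℝ η e₀ v (A e₀ y) z := by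
  have h1 : (fun e => η e (A e y) z) =ᶠ[𝓝 e₀] fun e => -η e y (J z) :=
    h.adjoint.mono fun e he => he y z
  have h2 := (h.diff_form.hasFDerivAt.clm_apply (h.diff_end.hasFDerivAt.clm_apply
    (hasFDerivAt_const y e₀))).clm_apply (hasFDerivAt_const z e₀)
  have h3 := congrArg (fun l : F →L[ℝ] ℝ => l v) h1.fderiv_eq
  rw [h2.fderiv, fderiv_fun_neg] at h3
  simp [h.fderiv_apply₂] at h3
  linarith

/-- Tensoriality: the derivatives of `Y` and `Z` cancel because `A² = -1`, leaving only derivatives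
of `A`. -/
lemma flatNijenhuis_eq (h : IsLocalPair η A J e₀) {Y Z : F → F} (hY : DifferentiableAt ℝ Y e₀)
    (hZ : DifferentiableAt ℝ Z e₀) :
    flatNijenhuis A Y Z e₀ = -fderiv ℝ A e₀ (A e₀ (Y e₀)) (Z e₀)
      + fderiv ℝ A e₀ (A e₀ (Z e₀)) (Y e₀) - A e₀ (fderiv ℝ A e₀ (Z e₀) (Y e₀))
      + A e₀ (fderiv ℝ A e₀ (Y e₀) (Z e₀)) := by
  have h1 := (h.diff_end.hasFDerivAt.clm_apply hY.hasFDerivAt).fderiv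
  have h2 := (h.diff_end.hasFDerivAt.clm_apply hZ.hasFDerivAt).fderiv
  simp only [flatNijenhuis, lieBracket_eq, h1, h2]
  simp [h.sq_end]
  abel

/-- The torsion of `A` in terms of the derivative of `η`, using that `η` is closed. -/
lemma form_flatNijenhuis (h : IsLocalPair η A J e₀) {Y Z : F → F} (hY : DifferentiableAt ℝ Y e₀)
    (hZ : DifferentiableAt ℝ Z e₀) (x : F) :
    η e₀ x (flatNijenhuis A Y Z e₀) = torsionForm η A J e₀ x (Y e₀) (Z e₀) := by
  rw [h.flatNijenhuis_eq hY hZ, h.skew_self]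
  generalize Y e₀ = y
  generalize Z e₀ = z
  simp only [map_add, map_sub, map_neg, add_apply,
    sub_apply, neg_apply, h.adjoint_self, h.fderiv_adjoint,
    h.sq, torsionForm]
  -- At this point `η` is differentiated along `y`, `z`, `A y` and `A z`. Each cyclic identity
  -- trades two such terms for one derivative along `x` or `J x`.
  have c1 := h.closed (A e₀ y) (A e₀ z) x
  have c2 := h.closed y z x
  have c3 := h.closed (A e₀ y) z (J x)
  have c4 := h.closed y (A e₀ z) (J x)
  have s1 := h.fderiv_skew (A e₀ z) x (A e₀ y)
  have s2 := h.fderiv_skew z x y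
  have s3 := h.fderiv_skew z (J x) (A e₀ y)
  have s4 := h.fderiv_skew (A e₀ z) (J x) y
  linarith

/-- Replacing `y` by `A y` multiplies `y - i A y` by `i`, just as replacing `x` by `J x` multiplies
`x - i J x` by `i`. -/
lemma torsionForm_apply_end (h : IsLocalPair η A J e₀) (x y z : F) :
    torsionForm η A J e₀ x (A e₀ y) z = torsionForm η A J e₀ (J x) y z := by
  simp only [torsionForm, h.sq_end, h.sq, map_neg, neg_apply]
  ring

lemma torsionForm_apply_end' (h : IsLocalPair η A J e₀) (x y z : F) :
    torsionForm η A J e₀ x y (A e₀ z) = torsionForm η A J e₀ (J x) y z := by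
  simp only [torsionForm, h.sq_end, h.sq, map_neg, neg_apply]
  ring

lemma torsionForm_sub_left (x y y' z : F) :
    torsionForm η A J e₀ x (y - y') z
      = torsionForm η A J e₀ x y z - torsionForm η A J e₀ x y' z := by
  simp only [torsionForm, map_sub, sub_apply]
  ring

lemma torsionForm_sub_right (x y z z' : F) :
    torsionForm η A J e₀ x y (z - z')
      = torsionForm η A J e₀ x y z - torsionForm η A J e₀ x y z' := by
  simp only [torsionForm, map_sub]
  ring

/-- The projection from vectors of type `(1,0)` for `J` to vectors of type `(1,0)` for `A` is
surjective. -/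
lemma surjective_sub (h : IsLocalPair η A J e₀) [FiniteDimensional ℝ F] (w : F) :
    ∃ y, y - A e₀ (J y) = w := by
  have hinj : Function.Injective (ContinuousLinearMap.id ℝ F - A e₀ ∘L J : F →L[ℝ] F) := by
    rw [injective_iff_map_eq_zero]
    intro y hy
    by_contra hne
    have hy' : A e₀ (J y) = y := (sub_eq_zero.1 (by simpa using hy)).symm
    have h1 := h.adjoint_self (J y) y
    have h2 := h.tames y hne
    have h3 := h.tames (J y) fun h0 => hne (by simpa [h0] using (h.sq y).symm)
    have h4 := h.skew_self y y
    rw [hy'] at h1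
    have h5 := h.skew_self (J y) (J y)
    -- Applying `A` to `A J y = y` gives `A y = -J y`. The adjoint relation at `(y, y)` then makes
    -- `η(J y, y)` equal to its own negative, against taming.
    have h6 := congrArg (A e₀) hy'
    rw [h.sq_end] at h6
    have h7 := h.adjoint_self y y
    rw [← h6] at h7
    have h8 := h.skew_self y (J y)
    simp only [map_neg, neg_apply] at h7
    linarith
  obtain ⟨y, hy⟩ := (LinearMap.injective_iff_surjective
    (f := (ContinuousLinearMap.id ℝ F - A e₀ ∘L J : F →L[ℝ] F).toLinearMap)).1 hinj w
  exact ⟨y, by simpa using hy⟩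

/-- The real part of the `(3,0)`-part of the torsion determines the torsion. -/
lemma torsionForm_eq_zero_iff (h : IsLocalPair η A J e₀) [FiniteDimensional ℝ F] :
    (∀ x y z, torsionForm η A J e₀ x y z = 0) ↔
      ∀ x y z, torsionForm η A J e₀ x y z - torsionForm η A J e₀ (J x) (J y) z
        - torsionForm η A J e₀ (J x) y (J z) - torsionForm η A J e₀ x (J y) (J z) = 0 := by
  refine ⟨fun H x y z => by simp [H], fun H x y z => ?_⟩
  -- With both arguments in the form `y - A J y`, `z - A J z`, moving every `A` onto the first slot
  -- as `J` turns the goal into the hypothesis at `x`, `y`, `z`.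
  obtain ⟨y, rfl⟩ := h.surjective_sub y
  obtain ⟨z, rfl⟩ := h.surjective_sub z
  rw [← H x y z]
  simp only [torsionForm_sub_left, torsionForm_sub_right, h.torsionForm_apply_end,
    h.torsionForm_apply_end', h.sq]
  simp only [torsionForm, h.sq, map_neg, neg_apply]
  ring

/-- The derivative of the Poisson bracket of two functions with `J`-linear differentials. -/
lemma hasFDerivAt_bracket (h : IsLocalPair η A J e₀) {u : F → F} {α β : F → F →L[ℝ] ℂ}
    (hu : DifferentiableAt ℝ u e₀) (hα : DifferentiableAt ℝ α e₀) (hβ : DifferentiableAt ℝ β e₀)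
    (huα : ∀ᶠ e in 𝓝 e₀, ∀ z, η e (u e) z = (α e z).re)
    (hβJ : ∀ z, β e₀ (J z) = Complex.I * β e₀ z)
    (hα' : ∀ v z, fderiv ℝ α e₀ v (J z) = Complex.I * fderiv ℝ α e₀ v z)
    (hα'' : ∀ v z, fderiv ℝ α e₀ (J v) z = Complex.I * fderiv ℝ α e₀ v z)
    (hβ'' : ∀ v z, fderiv ℝ β e₀ (J v) z = Complex.I * fderiv ℝ β e₀ v z)
    {w : F} (hw : ∀ z, η e₀ w z = (β e₀ z).re) :
    ∃ s' : F →L[ℝ] ℂ, HasFDerivAt (fun e => β e (J (u e) - A e (u e))) s' e₀ ∧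
      ∀ v, (s' (J v) - Complex.I * s' v) =
        -torsionForm η A J e₀ v (u e₀) w - Complex.I * torsionForm η A J e₀ (J v) (u e₀) w := by
  have h1 := hβ.hasFDerivAt.clm_apply ((J.hasFDerivAt.comp e₀ hu.hasFDerivAt).sub
    (h.diff_end.hasFDerivAt.clm_apply hu.hasFDerivAt))
  refine ⟨_, h1, fun v => ?_⟩
  -- If `w` represents `Re β`, then `A w` represents `Im β`, since `β` is complex linear and `A` is
  -- minus the adjoint of `J`.
  have hβ1 : ∀ z, β e₀ z = (η e₀ w z : ℂ) + Complex.I * η e₀ (A e₀ w) z := by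
    intro z
    apply Complex.ext
    · simp [hw]
    · have := congrArg Complex.re (hβJ z)
      simp at this
      simp [h.adjoint_self, hw, this]
  -- Differentiate the relation `η(u, z) = Re α(z)` defining `u`.
  have key : ∀ v z, η e₀ (fderiv ℝ u e₀ v) z
      = (fderiv ℝ α e₀ v z).re - fderiv ℝ η e₀ v (u e₀) z := by
    intro v z
    have h2 := (h.diff_form.hasFDerivAt.clm_apply hu.hasFDerivAt).clm_apply
      (hasFDerivAt_const z e₀)
    have h3 := Complex.reCLM.hasFDerivAt.comp e₀
      (hα.hasFDerivAt.clm_apply (hasFDerivAt_const z e₀))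
    have h4 : (fun e => η e (u e) z) =ᶠ[𝓝 e₀] fun e => Complex.reCLM (α e z) :=
      huα.mono fun e he => by simpa using he z
    have h5 := congrArg (fun l : F →L[ℝ] ℝ => l v) (h4.fderiv_eq.trans h3.fderiv)
    rw [h2.fderiv] at h5
    simp at h5
    linarith
  -- Moving `J` and `A` across `η` onto `w` lets `key` eliminate the derivative of `u`.
  have key2 : ∀ v w, η e₀ w (J (fderiv ℝ u e₀ v) - fderiv ℝ A e₀ v (u e₀)
        - A e₀ (fderiv ℝ u e₀ v))
      = (fderiv ℝ α e₀ v (A e₀ w - J w)).re - fderiv ℝ η e₀ v (u e₀) (A e₀ w)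
        - fderiv ℝ η e₀ v (A e₀ (u e₀)) w := by
    intro v w
    have e1 := h.adjoint_self w (fderiv ℝ u e₀ v)
    have e2 := h.skew_self (A e₀ w) (fderiv ℝ u e₀ v)
    have e3 := h.adjoint_right w (fderiv ℝ u e₀ v)
    have e4 := h.skew_self (J w) (fderiv ℝ u e₀ v)
    have e5 := h.skew_self w (fderiv ℝ A e₀ v (u e₀))
    have e6 := h.fderiv_adjoint v (u e₀) w
    have k1 := key v (A e₀ w)
    have k2 := key v (J w)
    simp only [map_sub, Complex.sub_re]
    linarith
  have key3 : ∀ v, β e₀ (J (fderiv ℝ u e₀ v) - (A e₀ (fderiv ℝ u e₀ v)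
      + fderiv ℝ A e₀ v (u e₀))) = 
      (((fderiv ℝ α e₀ v (A e₀ w - J w)).re - fderiv ℝ η e₀ v (u e₀) (A e₀ w)
        - fderiv ℝ η e₀ v (A e₀ (u e₀)) w : ℝ) : ℂ) + Complex.I *
      ((-(fderiv ℝ α e₀ v (w + J (A e₀ w))).re + fderiv ℝ η e₀ v (u e₀) w
        - fderiv ℝ η e₀ v (A e₀ (u e₀)) (A e₀ w) : ℝ) : ℂ) := by
    intro v
    rw [hβ1, sub_add_eq_sub_sub_swap, key2, key2, h.sq_end, ← neg_add' w, map_neg, map_neg,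
      Complex.neg_re, sub_neg_eq_add]
  -- The derivative of `α` is complex linear in the direction and in the argument; this makes its
  -- contributions to `s'(J v) - i s'(v)` cancel. Those of `β` cancel by `hβ''`.
  have e1 : ∀ v, (fderiv ℝ α e₀ (J v) (A e₀ w - J w)).re
      = (fderiv ℝ α e₀ v (w + J (A e₀ w))).re := by
    intro v
    rw [hα'', ← hα', map_sub, h.sq, sub_neg_eq_add, add_comm]
  have e2 : (fderiv ℝ α e₀ (J v) (w + J (A e₀ w))).re
      = -(fderiv ℝ α e₀ v (A e₀ w - J w)).re := by
    rw [← e1, h.sq, map_neg]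
    simp
  have hs : ∀ v, (((β e₀).comp (J.comp (fderiv ℝ u e₀) - ((A e₀).comp (fderiv ℝ u e₀)
      + (fderiv ℝ A e₀).flip (u e₀))) + (fderiv ℝ β e₀).flip (J (u e₀) - A e₀ (u e₀))) v)
      = β e₀ (J (fderiv ℝ u e₀ v) - (A e₀ (fderiv ℝ u e₀ v) + fderiv ℝ A e₀ v (u e₀)))
        + fderiv ℝ β e₀ v (J (u e₀) - A e₀ (u e₀)) := fun v => by simp
  change (((β e₀).comp (J.comp (fderiv ℝ u e₀) - ((A e₀).comp (fderiv ℝ u e₀)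
      + (fderiv ℝ A e₀).flip (u e₀))) + (fderiv ℝ β e₀).flip (J (u e₀) - A e₀ (u e₀))) (J v))
      - Complex.I * (((β e₀).comp (J.comp (fderiv ℝ u e₀) - ((A e₀).comp (fderiv ℝ u e₀)
      + (fderiv ℝ A e₀).flip (u e₀))) + (fderiv ℝ β e₀).flip (J (u e₀) - A e₀ (u e₀))) v) = _
  rw [hs, hs, hβ'', key3, key3, e1, e2]
  simp only [torsionForm, h.sq, map_neg, neg_apply]
  apply Complex.ext <;> simp <;> ring

end IsLocalPair

end Flat

/-! ### Pointwise linear algebra of `Ω`, `g`, `J₊` and `J₋`. -/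

section Algebra

section Pointwise

variable {V : Type*} [AddCommGroup V] [Module ℝ V] [TopologicalSpace V] [IsTopologicalAddGroup V]
  [ContinuousSMul ℝ V]

lemma isInvertible_of_nondegenerate [T2Space V] [FiniteDimensional ℝ V] (B : V →L[ℝ] V →L[ℝ] ℝ)
    (hB : ∀ v, (∀ w, B v w = 0) → v = 0) : B.IsInvertible := by
  have e : (V →L[ℝ] ℝ) ≃ₗ[ℝ] Module.Dual ℝ V := LinearMap.toContinuousLinearMap.symm
  have : FiniteDimensional ℝ (V →L[ℝ] ℝ) := e.symm.finiteDimensional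
  have hinj : Function.Injective B.toLinearMap := by
    rw [injective_iff_map_eq_zero]
    exact fun v hv => hB v fun w => by simpa using congrArg (fun l : V →L[ℝ] ℝ => l w) hv
  have hdim : Module.finrank ℝ V = Module.finrank ℝ (V →L[ℝ] ℝ) := by
    rw [e.finrank_eq, Subspace.dual_finrank_eq]
  refine ⟨(LinearEquiv.ofInjectiveOfFinrankEq B.toLinearMap hinj hdim).toContinuousLinearEquiv, ?_⟩
  ext v w
  rfl

end Pointwise

variable {E M : Type*} [NormedAddCommGroup E] [NormedSpace ℂ E]
  [TopologicalSpace M] [ChartedSpace E M]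

instance (x : M) : T2Space (T E x) := inferInstanceAs (T2Space E)

instance [FiniteDimensional ℂ E] (x : M) : FiniteDimensional ℝ (T E x) :=
  inferInstanceAs (FiniteDimensional ℝ E)

lemma Jplus_sq (x : M) (v : T E x) : Jplus E M x (Jplus E M x v) = -v := by
  have h : ∀ w : E, Complex.I • Complex.I • w = -w := fun w => by simp [smul_smul]
  exact h v

variable {Ω : BilinField E M} {x : M}

lemma form_Jminus (hΩ : (Ω x).IsInvertible) (y z : T E x) :
    Ω x (Jminus Ω x y) z = -Ω x y (Jplus E M x z) := by
  have h := hΩ.self_apply_inverse (ContinuousLinearMap.precomp ℝ (Jplus E M x) (Ω x y))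
  have h' : Ω x (Jminus Ω x y)
      = -Ω x ((Ω x).inverse (ContinuousLinearMap.precomp ℝ (Jplus E M x) (Ω x y))) :=
    map_neg (Ω x) _
  rw [h', h]
  rfl

lemma metric_apply (hΩ : (Ω x).IsInvertible) (y z : T E x) :
    metric Ω x y z = (1 / 2) * (Ω x (Jplus E M x y) z - Ω x y (Jplus E M x z)) := by
  simp [metric, form_Jminus hΩ, sub_eq_add_neg, mul_add]

/-- The value of `Q̃` in terms of the Poisson structure `Ω⁻¹`. -/
lemma Qtilde_apply (hΩ : (Ω x).IsInvertible) (hg : (metric Ω x).IsInvertible)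
    (hskew : ∀ v w : T E x, Ω x v w = -Ω x w v) (hsq : ∀ v, Jminus Ω x (Jminus Ω x v) = -v)
    (α β : T E x →L[ℝ] ℝ) {u : T E x} (hu : Ω x u = α) :
    Qtilde Ω x α β = 2 * β (Jplus E M x u - Jminus Ω x u) := by
  have hv : metric Ω x (dualVector Ω x α) = α := hg.self_apply_inverse α
  have hw : metric Ω x (dualVector Ω x β) = β := hg.self_apply_inverse β
  generalize hv' : dualVector Ω x α = v at hv
  generalize hw' : dualVector Ω x β = w at hw
  have hsymm : ∀ y z, metric Ω x y z = metric Ω x z y := by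
    intro y z
    rw [metric_apply hΩ, metric_apply hΩ, hskew z, hskew (Jplus E M x z)]
    ring
  -- This is `g = ½ Ω (J₊ + J₋)`, with `v` and `u` dual to the same covector `α` under `g` and `Ω`.
  have h2 : Jplus E M x v + Jminus Ω x v = (2 : ℝ) • u := by
    apply hΩ.injective
    have h3 : metric Ω x v = (1 / 2 : ℝ) • Ω x (Jplus E M x v + Jminus Ω x v) := rfl
    rw [map_smul, hu, ← hv, h3, smul_smul]
    norm_num
  -- Both squares are `-1`, so `[J₊, J₋] = (J₊ - J₋)(J₊ + J₋)`, and `h2` evaluates the second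
  -- factor.
  have h4 : Q Ω x v = (2 : ℝ) • (Jplus E M x u - Jminus Ω x u) := by
    have h5 : Q Ω x v = Jplus E M x (Jminus Ω x v) - Jminus Ω x (Jplus E M x v) := rfl
    have h6 := congrArg (Jplus E M x) h2
    have h7 := congrArg (Jminus Ω x) h2
    rw [map_add, map_smul] at h6 h7
    rw [hsq] at h7
    rw [Jplus_sq] at h6
    rw [h5, smul_sub, ← h6, ← h7]
    abel
  change metric Ω x (Q Ω x (dualVector Ω x α)) (dualVector Ω x β) = _
  rw [hv', hw', hsymm, hw, h4, map_smul, smul_eq_mul]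

lemma part10_eq_self {α : CCovector E x} (hα : ∀ z, α (Jplus E M x z) = Complex.I * α z) :
    part10 α = α := by
  ext z
  change (1 / 2 : ℂ) * (α z - Complex.I * α (Jplus E M x z)) = α z
  rw [hα, ← mul_assoc, Complex.I_mul_I]
  ring

/-- If `u` represents `Re α` under `Ω`, then `J₋ u` represents `Im α`. The real and imaginary parts
of `α` contribute equally, which doubles the factor `2` of `Qtilde_apply`. -/
lemma Qtilde20_apply (hΩ : (Ω x).IsInvertible) (hg : (metric Ω x).IsInvertible)
    (hskew : ∀ v w : T E x, Ω x v w = -Ω x w v) (hsq : ∀ v, Jminus Ω x (Jminus Ω x v) = -v)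
    {α β : CCovector E x} (hα : ∀ z, α (Jplus E M x z) = Complex.I * α z)
    (hβ : ∀ z, β (Jplus E M x z) = Complex.I * β z) {u : T E x}
    (hu : ∀ z, Ω x u z = (α z).re) :
    Qtilde20 Ω x α β = 4 * β (Jplus E M x u - Jminus Ω x u) := by
  have h1 : Ω x u = Complex.reCLM ∘L α := by ext z; simp [hu]
  have h2 : Ω x (Jminus Ω x u) = Complex.imCLM ∘L α := by
    ext z
    rw [form_Jminus hΩ, hu, hα]
    simp
  have h3 : ∀ z, (β (Jplus E M x z)).re = -(β z).im := fun z => by simp [hβ]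
  have h4 : ∀ z, (β (Jplus E M x z)).im = (β z).re := fun z => by simp [hβ]
  rw [Qtilde20, part10_eq_self hα, part10_eq_self hβ, complexify,
    Qtilde_apply hΩ hg hskew hsq _ _ h1, Qtilde_apply hΩ hg hskew hsq _ _ h1,
    Qtilde_apply hΩ hg hskew hsq _ _ h2, Qtilde_apply hΩ hg hskew hsq _ _ h2]
  have h5 : Jplus E M x (Jminus Ω x u) - Jminus Ω x (Jminus Ω x u)
      = Jplus E M x (Jminus Ω x u - Jplus E M x u) := by
    rw [hsq, map_sub, Jplus_sq]
  rw [h5]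
  apply Complex.ext
  · simp [h3, h4]
    ring
  · simp [h3, h4]
    ring

/-- The properties of `Ω` at a point used in the algebraic part of the argument. -/
structure TamedAt (Ω : BilinField E M) (x : M) : Prop where
  invertible : (Ω x).IsInvertible
  metric_invertible : (metric Ω x).IsInvertible
  sq : ∀ v, Jminus Ω x (Jminus Ω x v) = -v

/-- By skewness `g(v, v) = Ω(J₊ v, v)`, so taming makes `g` definite. -/
lemma tamedAt [FiniteDimensional ℂ E] (hskew : ∀ v w : T E x, Ω x v w = -Ω x w v)
    (hnd : ∀ v : T E x, (∀ w : T E x, Ω x v w = 0) → v = 0)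
    (htame : ∀ v : T E x, v ≠ 0 → 0 < Ω x (Jplus E M x v) v) : TamedAt Ω x := by
  have hΩ := isInvertible_of_nondegenerate (Ω x) hnd
  refine ⟨hΩ, isInvertible_of_nondegenerate _ fun v hv => ?_, fun v => ?_⟩
  · by_contra hne
    have h1 := htame v hne
    have h2 := hv v
    rw [metric_apply hΩ, hskew v] at h2
    linarith
  · rw [← sub_eq_zero]
    refine hnd _ fun z => ?_
    rw [map_sub, sub_apply, form_Jminus hΩ, form_Jminus hΩ, Jplus_sq]
    simp

end Algebra

/-! ### Transport of fields and forms to the preferred chart. -/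

section Charts

variable {E M : Type*} [NormedAddCommGroup E] [NormedSpace ℂ E]
  [TopologicalSpace M] [ChartedSpace E M]

/-- A holomorphic map is real differentiable, with the same derivative. -/
lemma hasMFDerivAt_restrictScalars {E' M' : Type*} [NormedAddCommGroup E'] [NormedSpace ℂ E']
    [TopologicalSpace M'] [ChartedSpace E' M'] {f : M → M'} {x : M}
    (hf : MDifferentiableAt 𝓘(ℂ, E) 𝓘(ℂ, E') f x) :
    HasMFDerivAt 𝓘(ℝ, E) 𝓘(ℝ, E') f x
      ((mfderiv 𝓘(ℂ, E) 𝓘(ℂ, E') f x : E →L[ℂ] E').restrictScalars ℝ : E →L[ℝ] E') :=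
  ⟨hf.hasMFDerivAt.1, HasFDerivWithinAt.restrictScalars ℝ (𝕜' := ℂ) (E := E) (F := E')
    hf.hasMFDerivAt.2⟩

/-- The inverse of the preferred chart at `x₀`, as a frame of the tangent bundle. -/
def chartFrame (x₀ : M) (e : E) : E →L[ℝ] T E ((extChartAt 𝓘(ℝ, E) x₀).symm e) :=
  mfderivWithin 𝓘(ℝ, E) 𝓘(ℝ, E) (extChartAt 𝓘(ℝ, E) x₀).symm (range 𝓘(ℝ, E)) e

/-- A vector field in the preferred chart at `x₀`. -/
def fieldInChart (x₀ : M) (X : VField E M) (e : E) : E :=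
  (chartFrame x₀ e).inverse (X ((extChartAt 𝓘(ℝ, E) x₀).symm e))

/-- A bilinear form in the preferred chart at `x₀`. -/
def formInChart (Ω : BilinField E M) (x₀ : M) (e : E) : E →L[ℝ] E →L[ℝ] ℝ :=
  ContinuousLinearMap.precomp ℝ (chartFrame x₀ e) ∘L
    Ω ((extChartAt 𝓘(ℝ, E) x₀).symm e) ∘L chartFrame x₀ e

/-- Multiplication by `i`. -/
def mulI (E : Type*) [NormedAddCommGroup E] [NormedSpace ℂ E] : E →L[ℝ] E :=
  Complex.I • ContinuousLinearMap.id ℝ E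

/-- The endomorphism field `J₋` in the preferred chart at `x₀`. -/
def endInChart (Ω : BilinField E M) (x₀ : M) (e : E) : E →L[ℝ] E :=
  -((formInChart Ω x₀ e).inverse ∘L ContinuousLinearMap.precomp ℝ (mulI E) ∘L formInChart Ω x₀ e)

lemma formInChart_apply (Ω : BilinField E M) (x₀ : M) (e v w : E) :
    formInChart Ω x₀ e v w = Ω _ (chartFrame x₀ e v) (chartFrame x₀ e w) := rfl

section

variable [IsManifold 𝓘(ℂ, E) ω M]

instance isManifold_real_one : IsManifold 𝓘(ℝ, E) 1 M :=
  IsManifold.of_le (n := ∞) (by simp)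

instance isManifold_real_two : IsManifold 𝓘(ℝ, E) 2 M :=
  IsManifold.of_le (n := ∞) (by exact WithTop.coe_le_coe.2 le_top)

instance isManifold_complex_one : IsManifold 𝓘(ℂ, E) 1 M :=
  IsManifold.of_le (n := ω) (by simp)

variable {x₀ : M} {e : E}

lemma isInvertible_chartFrame (he : e ∈ (extChartAt 𝓘(ℝ, E) x₀).target) :
    (chartFrame x₀ e).IsInvertible :=
  isInvertible_mfderivWithin_extChartAt_symm he

lemma hasMFDerivAt_chart_symm (he : e ∈ (extChartAt 𝓘(ℝ, E) x₀).target) :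
    HasMFDerivAt 𝓘(ℝ, E) 𝓘(ℝ, E) (extChartAt 𝓘(ℝ, E) x₀).symm e (chartFrame x₀ e) := by
  have h := (mdifferentiableWithinAt_extChartAt_symm he).hasMFDerivWithinAt
  rw [chartFrame]
  simpa using h

lemma mdifferentiableAt_chart_symm (he : e ∈ (extChartAt 𝓘(ℝ, E) x₀).target) :
    MDifferentiableAt 𝓘(ℂ, E) 𝓘(ℂ, E) (extChartAt 𝓘(ℝ, E) x₀).symm e := by
  have h := mdifferentiableWithinAt_extChartAt_symm (I := 𝓘(ℂ, E)) (x := x₀) (z := e)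
    (by simpa using he)
  rw [modelWithCornersSelf_coe, range_id] at h
  exact mdifferentiableWithinAt_univ.1 h

/-- The inverse chart is holomorphic, so its derivative is complex linear. Hence `J₊` is constant
throughout the chart, as `IsLocalPair` requires of `J`. -/
lemma chartFrame_mulI (he : e ∈ (extChartAt 𝓘(ℝ, E) x₀).target) (v : E) :
    chartFrame x₀ e (mulI E v) = Jplus E M _ (chartFrame x₀ e v) := by
  have h1 := mdifferentiableAt_chart_symm he
  have h2 := hasMFDerivAt_unique (hasMFDerivAt_chart_symm he) (hasMFDerivAt_restrictScalars h1)
  rw [h2]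
  exact map_smul (mfderiv 𝓘(ℂ, E) 𝓘(ℂ, E) (extChartAt 𝓘(ℝ, E) x₀).symm e : E →L[ℂ] E) Complex.I v

lemma chartFrame_self : chartFrame x₀ (extChartAt 𝓘(ℝ, E) x₀ x₀)
    = (ContinuousLinearMap.id ℝ E : E →L[ℝ] E) :=
  mfderivWithin_range_extChartAt_symm

lemma fieldInChart_self (X : VField E M) :
    fieldInChart x₀ X (extChartAt 𝓘(ℝ, E) x₀ x₀) = X x₀ := by
  have h1 : ∀ p, p = x₀ → (X p : E) = X x₀ := by rintro p rfl; rfl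
  have h2 := h1 _ (extChartAt_to_inv (I := 𝓘(ℝ, E)) x₀)
  exact (mfderivWithin_extChartAt_symm_inverse_apply (I := 𝓘(ℝ, E)) (x := x₀) _).trans h2

lemma formInChart_self (Ω : BilinField E M) (v w : E) :
    formInChart Ω x₀ (extChartAt 𝓘(ℝ, E) x₀ x₀) v w = Ω x₀ v w := by
  have h1 : ∀ p, p = x₀ → (Ω p : E →L[ℝ] E →L[ℝ] ℝ) v w = (Ω x₀ : E →L[ℝ] E →L[ℝ] ℝ) v w := by
    rintro p rfl; rfl
  rw [formInChart_apply]
  have h2 : ∀ v, chartFrame x₀ (extChartAt 𝓘(ℝ, E) x₀ x₀) v = (v : E) := fun v => by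
    rw [chartFrame_self]; rfl
  rw [h2, h2]
  exact h1 _ (extChartAt_to_inv (I := 𝓘(ℝ, E)) x₀)

lemma chartFrame_fieldInChart (he : e ∈ (extChartAt 𝓘(ℝ, E) x₀).target) (X : VField E M) :
    chartFrame x₀ e (fieldInChart x₀ X e) = X _ :=
  (isInvertible_chartFrame he).self_apply_inverse _

lemma bracket_eq (X Y : VField E M) :
    bracket X Y x₀ = lieBracket ℝ (fieldInChart x₀ X) (fieldInChart x₀ Y)
      (extChartAt 𝓘(ℝ, E) x₀ x₀) := by
  have key : ∀ L : E →L[ℝ] E, L = ContinuousLinearMap.id ℝ E → ∀ v, L.inverse v = v := by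
    rintro L rfl v
    rw [ContinuousLinearMap.inverse_id, ContinuousLinearMap.id_apply]
  have h : bracket X Y x₀ = lieBracketWithin ℝ (fieldInChart x₀ X) (fieldInChart x₀ Y)
      ((extChartAt 𝓘(ℝ, E) x₀).symm ⁻¹' univ ∩ range 𝓘(ℝ, E)) (extChartAt 𝓘(ℝ, E) x₀ x₀) :=
    key _ mfderiv_extChartAt_self _
  rw [h, preimage_univ, univ_inter, modelWithCornersSelf_coe, range_id, lieBracketWithin_univ]

lemma differentiableAt_fieldInChart [CompleteSpace E] {X : VField E M} {U : Set M} (hU : IsOpen U)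
    (hx : x₀ ∈ U) (hX : SmoothOn X U) :
    DifferentiableAt ℝ (fieldInChart x₀ X) (extChartAt 𝓘(ℝ, E) x₀ x₀) := by
  have h1 : MDifferentiableWithinAt 𝓘(ℝ, E) 𝓘(ℝ, E).tangent
      (fun x => (⟨x, X x⟩ : TangentBundle 𝓘(ℝ, E) M)) univ x₀ :=
    (((hX x₀ hx).contMDiffAt (hU.mem_nhds hx)).mdifferentiableAt (by simp)).mdifferentiableWithinAt
  have h2 : DifferentiableWithinAt ℝ (fieldInChart x₀ X)
      ((extChartAt 𝓘(ℝ, E) x₀).symm ⁻¹' univ ∩ range 𝓘(ℝ, E)) (extChartAt 𝓘(ℝ, E) x₀ x₀) :=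
    h1.differentiableWithinAt_mpullbackWithin_vectorField
  rwa [preimage_univ, univ_inter, modelWithCornersSelf_coe, range_id,
    differentiableWithinAt_univ] at h2

/-- The vector field which is constant in the preferred chart at `x₀`. -/
def constField (x₀ : M) (v : E) : VField E M := fun p =>
  (mfderiv 𝓘(ℝ, E) 𝓘(ℝ, E) (extChartAt 𝓘(ℝ, E) x₀) p).inverse v

lemma smoothOn_constField [CompleteSpace E] (x₀ : M) (v : E) :
    SmoothOn (constField x₀ v) (extChartAt 𝓘(ℝ, E) x₀).source := by
  intro p hp
  apply ContMDiffAt.contMDiffWithinAt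
  refine ContMDiffAt.mpullback_vectorField_preimage (I := 𝓘(ℝ, E)) (I' := 𝓘(ℝ, E)) (n := ∞)
    (V := fun _ => v)
    ?_ (contMDiffAt_extChartAt' (by simpa using hp)) (isInvertible_mfderiv_extChartAt hp) ?_
  · exact contMDiffAt_vectorSpace_iff_contDiffAt.2 contDiffAt_const
  · simp

lemma constField_symm (he : e ∈ (extChartAt 𝓘(ℝ, E) x₀).target) (v : E) :
    constField x₀ v ((extChartAt 𝓘(ℝ, E) x₀).symm e) = chartFrame x₀ e v := by
  refine (isInvertible_mfderiv_extChartAt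
    ((extChartAt 𝓘(ℝ, E) x₀).map_target he)).inverse_apply_eq.2 ?_
  exact (congrArg (fun l : E →L[ℝ] E => l v)
    (mfderiv_extChartAt_comp_mfderivWithin_extChartAt_symm he)).symm

lemma fieldInChart_constField (he : e ∈ (extChartAt 𝓘(ℝ, E) x₀).target) (v : E) :
    fieldInChart x₀ (constField x₀ v) e = v := by
  rw [fieldInChart, constField_symm he]
  exact (isInvertible_chartFrame he).inverse_apply_self v

lemma constField_self (v : E) : constField x₀ v x₀ = v := by
  rw [← fieldInChart_self (constField x₀ v), fieldInChart_constField (mem_extChartAt_target x₀)]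

end

end Charts

/-! ### The torsion of `J₋` and the form `ψ` in a chart. -/

section Torsion

variable {E M : Type*} [NormedAddCommGroup E] [NormedSpace ℂ E] [FiniteDimensional ℂ E]
  [TopologicalSpace M] [ChartedSpace E M] [IsManifold 𝓘(ℂ, E) ω M]
  {Ω : BilinField E M} {x₀ : M} {e : E}

omit [FiniteDimensional ℂ E] in
lemma contMDiffOn_form_apply (hΩ : IsSymplectic Ω) {X Y : VField E M} {U : Set M}
    (hX : SmoothOn X U) (hY : SmoothOn Y U) :
    ContMDiffOn 𝓘(ℝ, E) 𝓘(ℝ, ℝ) ∞ (fun p => Ω p (X p) (Y p)) U := by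
  intro p hp
  have : ContMDiffWithinAt 𝓘(ℝ, E) (𝓘(ℝ, E).prod 𝓘(ℝ)) ∞
      (fun m => Bundle.TotalSpace.mk' ℝ (E := Bundle.Trivial M ℝ) m (Ω m (X m) (Y m))) U p := by
    apply ContMDiffWithinAt.clm_bundle_apply₂ (F₁ := E) (F₂ := E)
      (E₁ := fun x : M => TangentSpace 𝓘(ℝ, E) x) (E₂ := fun x : M => TangentSpace 𝓘(ℝ, E) x)
    · exact (hΩ.smooth p).contMDiffWithinAt
    · exact hX p hp
    · exact hY p hp
  simp only [Bundle.contMDiffWithinAt_totalSpace] at this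
  exact this.2

lemma contDiffOn_form_constField (hΩ : IsSymplectic Ω) (x₀ : M) (v w : E) :
    ContDiffOn ℝ ∞ (fun e => formInChart Ω x₀ e v w) (extChartAt 𝓘(ℝ, E) x₀).target := by
  have : CompleteSpace E := FiniteDimensional.complete ℂ E
  have h1 := (contMDiffOn_form_apply hΩ (smoothOn_constField x₀ v) (smoothOn_constField x₀ w)).comp
    (contMDiffOn_extChartAt_symm x₀) (extChartAt 𝓘(ℝ, E) x₀).mapsTo_symm
  refine (contMDiffOn_iff_contDiffOn.1 h1).congr fun e he => ?_
  rw [Function.comp_apply, constField_symm he, constField_symm he]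
  rfl

/-- In finite dimension smoothness can be tested on entries, which are the values of `Ω` on
coordinate fields. -/
lemma contDiffOn_formInChart (hΩ : IsSymplectic Ω) (x₀ : M) :
    ContDiffOn ℝ ∞ (formInChart Ω x₀) (extChartAt 𝓘(ℝ, E) x₀).target :=
  contDiffOn_clm_apply.2 fun v => contDiffOn_clm_apply.2 fun w =>
    contDiffOn_form_constField hΩ x₀ v w

lemma differentiableAt_formInChart (hΩ : IsSymplectic Ω) (x₀ : M) :
    DifferentiableAt ℝ (formInChart Ω x₀) (extChartAt 𝓘(ℝ, E) x₀ x₀) :=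
  ((contDiffOn_formInChart hΩ x₀).contDiffAt (extChartAt_target_mem_nhds x₀)).differentiableAt
    (by simp)

omit [FiniteDimensional ℂ E] in
lemma formInChart_nondegenerate (hΩ : IsSymplectic Ω) (he : e ∈ (extChartAt 𝓘(ℝ, E) x₀).target)
    (v : E) (hv : ∀ w, formInChart Ω x₀ e v w = 0) : v = 0 := by
  have hθ := isInvertible_chartFrame he
  apply hθ.injective
  rw [map_zero]
  refine hΩ.nondegenerate _ _ fun w => ?_
  obtain ⟨w, rfl⟩ := hθ.surjective w
  exact hv w

lemma isInvertible_formInChart (hΩ : IsSymplectic Ω) (he : e ∈ (extChartAt 𝓘(ℝ, E) x₀).target) :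
    (formInChart Ω x₀ e).IsInvertible :=
  isInvertible_of_nondegenerate _ fun v hv => formInChart_nondegenerate hΩ he v hv

lemma formInChart_endInChart (hΩ : IsSymplectic Ω) (he : e ∈ (extChartAt 𝓘(ℝ, E) x₀).target)
    (y z : E) : formInChart Ω x₀ e (endInChart Ω x₀ e y) z = -formInChart Ω x₀ e y (mulI E z) := by
  have h := (isInvertible_formInChart hΩ he).self_apply_inverse
    (ContinuousLinearMap.precomp ℝ (mulI E) (formInChart Ω x₀ e y))
  simp only [endInChart, neg_apply, map_neg, ContinuousLinearMap.comp_apply, h]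
  rfl

lemma differentiableAt_endInChart (hΩ : IsSymplectic Ω) (x₀ : M) :
    DifferentiableAt ℝ (endInChart Ω x₀) (extChartAt 𝓘(ℝ, E) x₀ x₀) := by
  have : CompleteSpace E := FiniteDimensional.complete ℂ E
  have h1 := differentiableAt_formInChart hΩ x₀
  have h2 : DifferentiableAt ℝ (fun e => (formInChart Ω x₀ e).inverse)
      (extChartAt 𝓘(ℝ, E) x₀ x₀) :=
    (((isInvertible_formInChart hΩ (mem_extChartAt_target x₀)).contDiffAt_map_inverse
      (n := 1)).differentiableAt one_ne_zero).comp _ h1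
  exact (h2.clm_comp ((differentiableAt_const _).clm_comp h1)).neg

/-- Both sides satisfy the same adjoint relation with `J₊`, and `Ω` is nondegenerate. -/
lemma chartFrame_endInChart (hΩ : IsSymplectic Ω) (he : e ∈ (extChartAt 𝓘(ℝ, E) x₀).target)
    (v : E) : chartFrame x₀ e (endInChart Ω x₀ e v) = Jminus Ω _ (chartFrame x₀ e v) := by
  rw [← sub_eq_zero]
  refine hΩ.nondegenerate _ _ fun w => ?_
  obtain ⟨w, rfl⟩ := (isInvertible_chartFrame he).surjective w
  rw [map_sub, sub_apply, form_Jminus (isInvertible_of_nondegenerate _ (hΩ.nondegenerate _)),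
    ← formInChart_apply, formInChart_endInChart hΩ he, ← chartFrame_mulI he, formInChart_apply]
  simp

lemma fieldInChart_Jminus (hΩ : IsSymplectic Ω) (he : e ∈ (extChartAt 𝓘(ℝ, E) x₀).target)
    (X : VField E M) : fieldInChart x₀ (fun p => Jminus Ω p (X p)) e
      = endInChart Ω x₀ e (fieldInChart x₀ X e) := by
  refine (isInvertible_chartFrame he).injective ?_
  rw [chartFrame_fieldInChart he, chartFrame_endInChart hΩ he, chartFrame_fieldInChart he]

omit [FiniteDimensional ℂ E] in
lemma bracket_congr {X Y : VField E M} {V W : E → E}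
    (hX : ∀ e ∈ (extChartAt 𝓘(ℝ, E) x₀).target, fieldInChart x₀ X e = V e)
    (hY : ∀ e ∈ (extChartAt 𝓘(ℝ, E) x₀).target, fieldInChart x₀ Y e = W e) :
    bracket X Y x₀ = lieBracket ℝ V W (extChartAt 𝓘(ℝ, E) x₀ x₀) := by
  have hn := extChartAt_target_mem_nhds (I := 𝓘(ℝ, E)) x₀
  have h : lieBracket ℝ (fieldInChart x₀ X) (fieldInChart x₀ Y) (extChartAt 𝓘(ℝ, E) x₀ x₀)
      = lieBracket ℝ V W (extChartAt 𝓘(ℝ, E) x₀ x₀) :=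
    Filter.EventuallyEq.lieBracket_vectorField_eq (eventually_of_mem hn hX)
      (eventually_of_mem hn hY)
  exact (bracket_eq X Y).trans h

lemma endInChart_self (hΩ : IsSymplectic Ω) (v : E) :
    endInChart Ω x₀ (extChartAt 𝓘(ℝ, E) x₀ x₀) v = Jminus Ω x₀ v := by
  have h := fieldInChart_Jminus hΩ (mem_extChartAt_target (I := 𝓘(ℝ, E)) x₀) (constField x₀ v)
  rw [fieldInChart_self, fieldInChart_self, constField_self] at h
  exact h.symm

lemma nijenhuis_eq (hΩ : IsSymplectic Ω) (X Y : VField E M) :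
    nijenhuis (Jminus Ω) X Y x₀ = flatNijenhuis (endInChart Ω x₀) (fieldInChart x₀ X)
      (fieldInChart x₀ Y) (extChartAt 𝓘(ℝ, E) x₀ x₀) := by
  have hX := fun e (he : e ∈ (extChartAt 𝓘(ℝ, E) x₀).target) => fieldInChart_Jminus hΩ he X
  have hY := fun e (he : e ∈ (extChartAt 𝓘(ℝ, E) x₀).target) => fieldInChart_Jminus hΩ he Y
  simp only [nijenhuis, flatNijenhuis, bracket_congr hX hY,
    bracket_congr hX (fun _ _ => rfl : ∀ e ∈ _, fieldInChart x₀ Y e = fieldInChart x₀ Y e),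
    bracket_congr (fun _ _ => rfl : ∀ e ∈ _, fieldInChart x₀ X e = fieldInChart x₀ X e) hY,
    bracket_eq X Y, endInChart_self hΩ]
  rfl

omit [FiniteDimensional ℂ E] [IsManifold 𝓘(ℂ, E) ω M] in
lemma deriv_eq_fderiv {f : M → ℝ} (hf : MDifferentiableAt 𝓘(ℝ, E) 𝓘(ℝ, ℝ) f x₀)
    (Z : VField E M) : deriv Z f x₀
      = fderiv ℝ (fun e => f ((extChartAt 𝓘(ℝ, E) x₀).symm e)) (extChartAt 𝓘(ℝ, E) x₀ x₀)
        (Z x₀) := by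
  rw [deriv, hf.mfderiv, modelWithCornersSelf_coe, range_id, fderivWithin_univ]
  rfl

lemma deriv_form_constField (hΩ : IsSymplectic Ω) (v w z : E) :
    deriv (constField x₀ v) (fun p => Ω p (constField x₀ w p) (constField x₀ z p)) x₀
      = fderiv ℝ (formInChart Ω x₀) (extChartAt 𝓘(ℝ, E) x₀ x₀) v w z := by
  have : CompleteSpace E := FiniteDimensional.complete ℂ E
  have hs := contMDiffOn_form_apply hΩ (smoothOn_constField x₀ w) (smoothOn_constField x₀ z)
  have hd : MDifferentiableAt 𝓘(ℝ, E) 𝓘(ℝ, ℝ)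
      (fun p => Ω p (constField x₀ w p) (constField x₀ z p)) x₀ :=
    ((hs x₀ (mem_extChartAt_source x₀)).contMDiffAt
      (extChartAt_source_mem_nhds x₀)).mdifferentiableAt (by simp)
  have h1 : (fun e => Ω ((extChartAt 𝓘(ℝ, E) x₀).symm e) (constField x₀ w _) (constField x₀ z _))
      =ᶠ[𝓝 (extChartAt 𝓘(ℝ, E) x₀ x₀)] fun e => formInChart Ω x₀ e w z := by
    filter_upwards [extChartAt_target_mem_nhds (I := 𝓘(ℝ, E)) x₀] with e he
    rw [constField_symm he, constField_symm he]
    rfl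
  have h2 := ((differentiableAt_formInChart hΩ x₀).hasFDerivAt.clm_apply
    (hasFDerivAt_const w _)).clm_apply (hasFDerivAt_const z _)
  rw [deriv_eq_fderiv hd, h1.fderiv_eq, h2.fderiv, constField_self]
  simp

/-- Coordinate fields commute, so the bracket terms of `dΩ` drop out. -/
lemma fderiv_formInChart_closed (hΩ : IsSymplectic Ω) (x y z : E) :
    fderiv ℝ (formInChart Ω x₀) (extChartAt 𝓘(ℝ, E) x₀ x₀) x y z
      + fderiv ℝ (formInChart Ω x₀) (extChartAt 𝓘(ℝ, E) x₀ x₀) y z x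
      + fderiv ℝ (formInChart Ω x₀) (extChartAt 𝓘(ℝ, E) x₀ x₀) z x y = 0 := by
  have : CompleteSpace E := FiniteDimensional.complete ℂ E
  have h := hΩ.closed _ (isOpen_extChartAt_source x₀) _ _ _ (smoothOn_constField x₀ x)
    (smoothOn_constField x₀ y) (smoothOn_constField x₀ z) x₀ (mem_extChartAt_source x₀)
  have hb : ∀ v w : E, bracket (constField x₀ v) (constField x₀ w) x₀ = 0 := by
    intro v w
    rw [bracket_congr (fun e he => fieldInChart_constField he v)
      (fun e he => fieldInChart_constField he w), lieBracket_eq]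
    simp
    rfl
  simp only [extDeriv₂, deriv_form_constField hΩ, hb] at h
  simpa using h

lemma isLocalPair (hΩ : IsSymplectic Ω) (htame : Tames Ω (complexStructure E M)) (x₀ : M) :
    IsLocalPair (formInChart Ω x₀) (endInChart Ω x₀) (mulI E) (extChartAt 𝓘(ℝ, E) x₀ x₀) where
  diff_form := differentiableAt_formInChart hΩ x₀
  diff_end := differentiableAt_endInChart hΩ x₀
  skew := Eventually.of_forall fun e y z => hΩ.skew _ _ _
  adjoint := by
    filter_upwards [extChartAt_target_mem_nhds (I := 𝓘(ℝ, E)) x₀] with e he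
    exact formInChart_endInChart hΩ he
  sq v := by simp [mulI, smul_smul]
  nondegenerate := formInChart_nondegenerate hΩ (mem_extChartAt_target x₀)
  closed := fderiv_formInChart_closed hΩ
  tames v hv := by
    rw [formInChart_self]
    exact htame x₀ v hv

lemma psi_eq (hΩ : IsSymplectic Ω) (htame : Tames Ω (complexStructure E M)) (X : VField E M)
    {Y Z : VField E M} (hY : DifferentiableAt ℝ (fieldInChart x₀ Y) (extChartAt 𝓘(ℝ, E) x₀ x₀))
    (hZ : DifferentiableAt ℝ (fieldInChart x₀ Z) (extChartAt 𝓘(ℝ, E) x₀ x₀)) :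
    psi Ω X Y Z x₀ = torsionForm (formInChart Ω x₀) (endInChart Ω x₀) (mulI E)
      (extChartAt 𝓘(ℝ, E) x₀ x₀) (X x₀) (Y x₀) (Z x₀) := by
  have h := (isLocalPair hΩ htame x₀).form_flatNijenhuis hY hZ (X x₀)
  rw [fieldInChart_self, fieldInChart_self] at h
  have h1 : psi Ω X Y Z x₀ = Ω x₀ (X x₀) _ := congrArg (Ω x₀ (X x₀)) (nijenhuis_eq hΩ Y Z)
  exact (h1.trans (formInChart_self Ω _ _).symm).trans h

omit [FiniteDimensional ℂ E] in
lemma fieldInChart_JF (he : e ∈ (extChartAt 𝓘(ℝ, E) x₀).target) (X : VField E M) :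
    fieldInChart x₀ (JF X) e = mulI E (fieldInChart x₀ X e) := by
  refine (isInvertible_chartFrame he).injective ?_
  rw [chartFrame_fieldInChart he, chartFrame_mulI he, chartFrame_fieldInChart he]
  rfl

omit [FiniteDimensional ℂ E] in
lemma differentiableAt_fieldInChart_JF {X : VField E M}
    (hX : DifferentiableAt ℝ (fieldInChart x₀ X) (extChartAt 𝓘(ℝ, E) x₀ x₀)) :
    DifferentiableAt ℝ (fieldInChart x₀ (JF X)) (extChartAt 𝓘(ℝ, E) x₀ x₀) := by
  refine ((mulI E).differentiableAt.comp _ hX).congr_of_eventuallyEq ?_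
  filter_upwards [extChartAt_target_mem_nhds (I := 𝓘(ℝ, E)) x₀] with e he
  exact fieldInChart_JF he X

/-- Only `Y` and `Z` are differentiated; `X` enters through its value. Introducing `t`, `x`, `y`,
`z` by equations places the right-hand side over `E` instead of the tangent space. -/
lemma psi30_eq (hΩ : IsSymplectic Ω) (htame : Tames Ω (complexStructure E M)) (X : VField E M)
    {Y Z : VField E M} (hY : DifferentiableAt ℝ (fieldInChart x₀ Y) (extChartAt 𝓘(ℝ, E) x₀ x₀))
    (hZ : DifferentiableAt ℝ (fieldInChart x₀ Z) (extChartAt 𝓘(ℝ, E) x₀ x₀)) :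
    ∀ t, t = torsionForm (formInChart Ω x₀) (endInChart Ω x₀) (mulI E)
      (extChartAt 𝓘(ℝ, E) x₀ x₀) → ∀ x y z : E, X x₀ = x → Y x₀ = y → Z x₀ = z →
    psi30 Ω X Y Z x₀ = (1 / 8 : ℂ) *
      (((t x y z - t (mulI E x) (mulI E y) z - t (mulI E x) y (mulI E z)
        - t x (mulI E y) (mulI E z) : ℝ) : ℂ)
      + Complex.I * ((t (mulI E x) (mulI E y) (mulI E z) - t (mulI E x) y z - t x (mulI E y) z
        - t x y (mulI E z) : ℝ) : ℂ)) := by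
  rintro t rfl x y z rfl rfl rfl
  have hJY := differentiableAt_fieldInChart_JF hY
  have hJZ := differentiableAt_fieldInChart_JF hZ
  simp only [psi30, psi_eq hΩ htame _ hY hZ, psi_eq hΩ htame _ hJY hZ, psi_eq hΩ htame _ hY hJZ,
    psi_eq hΩ htame _ hJY hJZ]
  rfl

/-- The `(3,0)`-part of `ψ` at a point determines the torsion there. -/
lemma torsionForm_eq_zero_of_psi30 (hΩ : IsSymplectic Ω) (htame : Tames Ω (complexStructure E M))
    (H : ∀ U : Set M, IsOpen U → ∀ X Y Z : VField E M,
        SmoothOn X U → SmoothOn Y U → SmoothOn Z U → ∀ x ∈ U, psi30 Ω X Y Z x = 0) (x y z : E) :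
    torsionForm (formInChart Ω x₀) (endInChart Ω x₀) (mulI E)
      (extChartAt 𝓘(ℝ, E) x₀ x₀) x y z = 0 := by
  have : CompleteSpace E := FiniteDimensional.complete ℂ E
  have hl := isLocalPair hΩ htame x₀
  have : FiniteDimensional ℝ E := FiniteDimensional.complexToReal E
  refine hl.torsionForm_eq_zero_iff.2 (fun x y z => ?_) x y z
  -- Arbitrary vectors at `x₀` extend to smooth fields near `x₀` that are constant in the chart.
  have hs := smoothOn_constField x₀ (E := E)
  have ho := isOpen_extChartAt_source (I := 𝓘(ℝ, E)) x₀
  have hm := mem_extChartAt_source (I := 𝓘(ℝ, E)) x₀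
  have h1 := H _ ho _ _ _ (hs x) (hs y) (hs z) x₀ hm
  rw [psi30_eq hΩ htame _ (differentiableAt_fieldInChart ho hm (hs y))
    (differentiableAt_fieldInChart ho hm (hs z)) _ rfl x y z (constField_self x)
    (constField_self y) (constField_self z)] at h1
  have h2 := (mul_eq_zero.1 h1).resolve_left (by norm_num)
  simpa using congrArg Complex.re h2

lemma psi30_eq_zero (hΩ : IsSymplectic Ω) (htame : Tames Ω (complexStructure E M))
    (H : ∀ x y z, torsionForm (formInChart Ω x₀) (endInChart Ω x₀) (mulI E)
      (extChartAt 𝓘(ℝ, E) x₀ x₀) x y z = 0) {U : Set M} (hU : IsOpen U) (hx : x₀ ∈ U)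
    (X : VField E M) {Y Z : VField E M} (hY : SmoothOn Y U) (hZ : SmoothOn Z U) :
    psi30 Ω X Y Z x₀ = 0 := by
  have : CompleteSpace E := FiniteDimensional.complete ℂ E
  obtain ⟨t, ht⟩ : ∃ t, t = torsionForm (formInChart Ω x₀) (endInChart Ω x₀) (mulI E)
    (extChartAt 𝓘(ℝ, E) x₀ x₀) := ⟨_, rfl⟩
  obtain ⟨x, hx'⟩ : ∃ x : E, X x₀ = x := ⟨_, rfl⟩
  obtain ⟨y, hy'⟩ : ∃ y : E, Y x₀ = y := ⟨_, rfl⟩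
  obtain ⟨z, hz'⟩ : ∃ z : E, Z x₀ = z := ⟨_, rfl⟩
  rw [← ht] at H
  rw [psi30_eq hΩ htame X (differentiableAt_fieldInChart hU hx hY)
    (differentiableAt_fieldInChart hU hx hZ) t ht x y z hx' hy' hz']
  simp [H]

end Torsion

/-! ### Holomorphy of the coefficients of `Q̃^{(2,0)}`. -/

section Holomorphy

section Linear

variable {E : Type*} [NormedAddCommGroup E] [NormedSpace ℂ E]

/-- A real differentiable map is complex differentiable if and only if its derivative commutes
with multiplication by `i`. -/
lemma differentiableAt_complex_iff {f : E → ℂ} {f' : E →L[ℝ] ℂ} {e : E} (hf : HasFDerivAt f f' e) :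
    DifferentiableAt ℂ f e ↔ ∀ v, f' (mulI E v) = Complex.I * f' v := by
  rw [differentiableAt_iff_restrictScalars ℝ hf.differentiableAt, hf.fderiv]
  constructor
  · rintro ⟨g, rfl⟩ v
    exact map_smul g Complex.I v
  · intro h
    refine ⟨⟨⟨f'.toLinearMap.toAddMonoidHom.toAddHom, fun c v => ?_⟩, f'.continuous⟩, rfl⟩
    have h1 : c • v = c.re • v + c.im • mulI E v := by
      conv_lhs => rw [← Complex.re_add_im c, add_smul, mul_smul]
      rfl
    change f' (c • v) = c * f' v
    rw [h1, map_add, map_smul, map_smul, h, Complex.real_smul, Complex.real_smul]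
    conv_rhs => rw [← Complex.re_add_im c]
    ring

end Linear

variable {E M : Type*} [NormedAddCommGroup E] [NormedSpace ℂ E] [FiniteDimensional ℂ E]
  [TopologicalSpace M] [ChartedSpace E M] [IsManifold 𝓘(ℂ, E) ω M]
  {Ω : BilinField E M} {x₀ : M} {e : E}

/-- The real part of a complex linear functional. -/
def rePart (E : Type*) [NormedAddCommGroup E] [NormedSpace ℂ E] : (E →L[ℂ] ℂ) →L[ℝ] (E →L[ℝ] ℝ) :=
  ContinuousLinearMap.compL ℝ E ℂ ℝ Complex.reCLM ∘L
    ContinuousLinearMap.restrictScalarsL ℂ E ℂ ℝ ℝ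

omit [FiniteDimensional ℂ E] in
lemma rePart_apply (α : E →L[ℂ] ℂ) (z : E) : rePart E α z = (α z).re := rfl

/-- The Hamiltonian vector in the preferred chart at `x₀` of the real part of a covector. -/
def hamiltonian (Ω : BilinField E M) (x₀ : M) (e : E) (α : E →L[ℂ] ℂ) : E :=
  (formInChart Ω x₀ e).inverse (rePart E α)

lemma formInChart_hamiltonian (hΩ : IsSymplectic Ω) (he : e ∈ (extChartAt 𝓘(ℝ, E) x₀).target)
    (α : E →L[ℂ] ℂ) (z : E) : formInChart Ω x₀ e (hamiltonian Ω x₀ e α) z = (α z).re := by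
  rw [hamiltonian, (isInvertible_formInChart hΩ he).self_apply_inverse, rePart_apply]

/-- The holomorphic Poisson bracket of two functions with differentials `α`, `β`, in the preferred
chart at `x₀`. -/
def poisson (Ω : BilinField E M) (x₀ : M) (e : E) (α β : E →L[ℂ] ℂ) : ℂ :=
  4 * β (mulI E (hamiltonian Ω x₀ e α) - endInChart Ω x₀ e (hamiltonian Ω x₀ e α))

/-- The Poisson bracket of holomorphic functions is complex differentiable at a point if and only
if the corresponding components of the torsion vanish. -/
lemma differentiableAt_poisson_iff (hΩ : IsSymplectic Ω) (htame : Tames Ω (complexStructure E M))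
    {G H : E → E →L[ℂ] ℂ} (hG : DifferentiableAt ℂ G (extChartAt 𝓘(ℝ, E) x₀ x₀))
    (hH : DifferentiableAt ℂ H (extChartAt 𝓘(ℝ, E) x₀ x₀)) :
    DifferentiableAt ℂ (fun e => poisson Ω x₀ e (G e) (H e)) (extChartAt 𝓘(ℝ, E) x₀ x₀) ↔
      ∀ v, torsionForm (formInChart Ω x₀) (endInChart Ω x₀) (mulI E) (extChartAt 𝓘(ℝ, E) x₀ x₀) v
        (hamiltonian Ω x₀ (extChartAt 𝓘(ℝ, E) x₀ x₀) (G (extChartAt 𝓘(ℝ, E) x₀ x₀)))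
        (hamiltonian Ω x₀ (extChartAt 𝓘(ℝ, E) x₀ x₀) (H (extChartAt 𝓘(ℝ, E) x₀ x₀))) = 0 := by
  have : CompleteSpace E := FiniteDimensional.complete ℂ E
  have hl := isLocalPair hΩ htame x₀
  have hmem := mem_extChartAt_target (I := 𝓘(ℝ, E)) x₀
  have hnhds := extChartAt_target_mem_nhds (I := 𝓘(ℝ, E)) x₀
  have hinv : DifferentiableAt ℝ (fun e => (formInChart Ω x₀ e).inverse)
      (extChartAt 𝓘(ℝ, E) x₀ x₀) :=
    (((isInvertible_formInChart hΩ hmem).contDiffAt_map_inverse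
      (n := 1)).differentiableAt one_ne_zero).comp _ hl.diff_form
  generalize extChartAt 𝓘(ℝ, E) x₀ x₀ = e₀ at *
  have hres : ∀ {K : E → E →L[ℂ] ℂ}, DifferentiableAt ℂ K e₀ →
      HasFDerivAt (fun e => ContinuousLinearMap.restrictScalarsL ℂ E ℂ ℝ ℝ (K e))
        (ContinuousLinearMap.restrictScalarsL ℂ E ℂ ℝ ℝ ∘L (fderiv ℂ K e₀).restrictScalars ℝ) e₀ :=
    fun {K} hK => (ContinuousLinearMap.restrictScalarsL ℂ E ℂ ℝ ℝ).hasFDerivAt.comp e₀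
      (hK.hasFDerivAt.restrictScalars ℝ)
  have hu : DifferentiableAt ℝ (fun e => hamiltonian Ω x₀ e (G e)) e₀ :=
    hinv.clm_apply ((rePart E).differentiableAt.comp e₀ (hG.restrictScalars ℝ))
  obtain ⟨s', hs', hs⟩ := hl.hasFDerivAt_bracket (u := fun e => hamiltonian Ω x₀ e (G e))
    (α := fun e => ContinuousLinearMap.restrictScalarsL ℂ E ℂ ℝ ℝ (G e))
    (β := fun e => ContinuousLinearMap.restrictScalarsL ℂ E ℂ ℝ ℝ (H e))
    (w := hamiltonian Ω x₀ e₀ (H e₀)) hu (hres hG).differentiableAt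
    (hres hH).differentiableAt
    (by filter_upwards [hnhds] with e he using formInChart_hamiltonian hΩ he (G e))
    (fun z => map_smul (H e₀) Complex.I z)
    (fun v z => by
      rw [(hres hG).fderiv]
      exact map_smul (fderiv ℂ G e₀ v) Complex.I z)
    (fun v z => by
      rw [(hres hG).fderiv]
      exact congrArg (fun l : E →L[ℂ] ℂ => l z) (map_smul (fderiv ℂ G e₀) Complex.I v))
    (fun v z => by
      rw [(hres hH).fderiv]
      exact congrArg (fun l : E →L[ℂ] ℂ => l z) (map_smul (fderiv ℂ H e₀) Complex.I v))
    (formInChart_hamiltonian hΩ hmem (H e₀))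
  have h4 : HasFDerivAt (fun e => poisson Ω x₀ e (G e) (H e)) ((4 : ℂ) • s') e₀ := 
    hs'.const_smul (4 : ℂ)
  rw [differentiableAt_complex_iff h4]
  constructor
  · intro h v
    have h5 := h v
    have h6 : s' (mulI E v) - Complex.I * s' v = 0 := by
      simp only [smul_apply, smul_eq_mul] at h5
      linear_combination h5 / 4
    rw [hs] at h6
    -- The real part suffices: the imaginary part is the same statement at `J v`.
    simpa using congrArg Complex.re h6
  · intro h v
    have h6 := hs v
    rw [h, h] at h6
    simp only [smul_apply, smul_eq_mul]
    simp at h6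
    linear_combination 4 * h6

omit [FiniteDimensional ℂ E] in
/-- The differential of a holomorphic function, in the preferred chart at `x₀`. -/
lemma differential_chartFrame {f : M → ℂ} (he : e ∈ (extChartAt 𝓘(ℝ, E) x₀).target)
    (hf : MDifferentiableAt 𝓘(ℂ, E) 𝓘(ℂ, ℂ) f ((extChartAt 𝓘(ℝ, E) x₀).symm e)) (v : E) :
    differential f _ (chartFrame x₀ e v)
      = fderiv ℂ (fun e => f ((extChartAt 𝓘(ℝ, E) x₀).symm e)) e v := by
  have h1 := (hasMFDerivAt_restrictScalars hf).mdifferentiableAt.hasMFDerivAt.comp e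
    (hasMFDerivAt_chart_symm he)
  have h2 : DifferentiableAt ℂ (fun e => f ((extChartAt 𝓘(ℝ, E) x₀).symm e)) e :=
    (hf.comp e (mdifferentiableAt_chart_symm he)).differentiableAt
  have h3 := hasMFDerivAt_unique h1 (h2.hasFDerivAt.restrictScalars ℝ).hasMFDerivAt
  exact congrArg (fun L : E →L[ℝ] ℂ => L v) h3

omit [FiniteDimensional ℂ E] [IsManifold 𝓘(ℂ, E) ω M] in
lemma differential_Jplus {f : M → ℂ} {p : M}
    (hf : MDifferentiableAt 𝓘(ℂ, E) 𝓘(ℂ, ℂ) f p) (v : T E p) :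
    differential f p (Jplus E M p v) = Complex.I * differential f p v := by
  have h := (hasMFDerivAt_restrictScalars hf).mfderiv
  rw [differential, h]
  have h1 : ∀ (L : E →L[ℂ] ℂ) (w : E), L (Complex.I • w) = Complex.I * L w :=
    fun L w => map_smul L Complex.I w
  exact h1 (mfderiv 𝓘(ℂ, E) 𝓘(ℂ, ℂ) f p) v

/-- The coefficients of the `(2,0)`-part of `Q̃` are Poisson brackets of holomorphic functions. -/
lemma Qtilde20_differential (hΩ : IsSymplectic Ω) (htame : Tames Ω (complexStructure E M))
    {f h : M → ℂ} (he : e ∈ (extChartAt 𝓘(ℝ, E) x₀).target)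
    (hf : MDifferentiableAt 𝓘(ℂ, E) 𝓘(ℂ, ℂ) f ((extChartAt 𝓘(ℝ, E) x₀).symm e))
    (hh : MDifferentiableAt 𝓘(ℂ, E) 𝓘(ℂ, ℂ) h ((extChartAt 𝓘(ℝ, E) x₀).symm e)) :
    Qtilde20 Ω _ (differential f _) (differential h ((extChartAt 𝓘(ℝ, E) x₀).symm e))
      = poisson Ω x₀ e (fderiv ℂ (fun e => f ((extChartAt 𝓘(ℝ, E) x₀).symm e)) e)
        (fderiv ℂ (fun e => h ((extChartAt 𝓘(ℝ, E) x₀).symm e)) e) := by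
  have hp := tamedAt (hΩ.skew _) (hΩ.nondegenerate _) (htame ((extChartAt 𝓘(ℝ, E) x₀).symm e))
  rw [Qtilde20_apply hp.invertible hp.metric_invertible (hΩ.skew _) hp.sq
    (differential_Jplus hf) (differential_Jplus hh)
    (u := chartFrame x₀ e (hamiltonian Ω x₀ e
      (fderiv ℂ (fun e => f ((extChartAt 𝓘(ℝ, E) x₀).symm e)) e))), poisson,
    ← differential_chartFrame he hh, ← chartFrame_mulI he, ← chartFrame_endInChart hΩ he,
    ← map_sub (chartFrame x₀ e)]
  intro z
  obtain ⟨z, rfl⟩ := (isInvertible_chartFrame he).surjective z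
  rw [← formInChart_apply, formInChart_hamiltonian hΩ he, differential_chartFrame he hf]

/-- Every real covector is the real part of a complex linear functional. -/
lemma exists_hamiltonian_eq (hΩ : IsSymplectic Ω) (he : e ∈ (extChartAt 𝓘(ℝ, E) x₀).target)
    (u : E) : ∃ l : E →L[ℂ] ℂ, hamiltonian Ω x₀ e l = u := by
  refine ⟨StrongDual.extendRCLike (𝕜 := ℂ) (formInChart Ω x₀ e u), ?_⟩
  rw [hamiltonian, (isInvertible_formInChart hΩ he).inverse_apply_eq]
  ext z
  exact StrongDual.re_extendRCLike_apply (𝕜 := ℂ) (formInChart Ω x₀ e u) z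

omit [FiniteDimensional ℂ E] in
lemma mdifferentiableAt_iff_chart {s : M → ℂ} :
    MDifferentiableAt 𝓘(ℂ, E) 𝓘(ℂ, ℂ) s x₀ ↔
      DifferentiableAt ℂ (fun e => s ((extChartAt 𝓘(ℝ, E) x₀).symm e))
        (extChartAt 𝓘(ℝ, E) x₀ x₀) := by
  rw [mdifferentiableAt_iff_source_of_mem_source (mem_chart_source E x₀),
    modelWithCornersSelf_coe, range_id, mdifferentiableWithinAt_univ,
    mdifferentiableAt_iff_differentiableAt]
  rfl

omit [FiniteDimensional ℂ E] in
lemma contMDiffAt_coordinate {φ : OpenPartialHomeomorph M E} (hφ : φ ∈ atlas E M)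
    {p : M} (hp : p ∈ φ.source) (l : E →L[ℂ] ℂ) :
    ContMDiffAt 𝓘(ℂ, E) 𝓘(ℂ, ℂ) ω (fun p => l (φ p)) p :=
  l.contDiff.contMDiff.contMDiffAt.comp p
    (contMDiffAt_of_mem_maximalAtlas (IsManifold.subset_maximalAtlas hφ) hp)

omit [FiniteDimensional ℂ E] in
-- The coordinates of another chart `φ` have nonconstant differentials in the preferred chart, but
-- these vary holomorphically because transition maps do.
lemma differentiableAt_fderiv_coordinate {φ : OpenPartialHomeomorph M E} (hφ : φ ∈ atlas E M)
    (hx : x₀ ∈ φ.source) (l : E →L[ℂ] ℂ) :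
    DifferentiableAt ℂ (fderiv ℂ fun e => l (φ ((extChartAt 𝓘(ℝ, E) x₀).symm e)))
      (extChartAt 𝓘(ℝ, E) x₀ x₀) := by
  have h1 : ContMDiffAt 𝓘(ℂ, E) 𝓘(ℂ, ℂ) ω
      (fun e => l (φ ((extChartAt 𝓘(ℂ, E) x₀).symm e))) (extChartAt 𝓘(ℂ, E) x₀ x₀) := by
    refine ContMDiffAt.comp_of_eq (g := fun p => l (φ p)) (y := x₀)
      (contMDiffAt_coordinate hφ hx l)
      ((contMDiffOn_extChartAt_symm x₀).contMDiffAt (extChartAt_target_mem_nhds x₀)) ?_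
    simp
  exact ((contMDiffAt_iff_contDiffAt.1 h1).fderiv_right (m := 1) le_top).differentiableAt
    one_ne_zero

/-- A coefficient of the `(2,0)`-part of `Q̃` is complex differentiable at `x₀` if and only if the
corresponding components of the torsion vanish. -/
lemma mdifferentiableAt_Qtilde20_iff (hΩ : IsSymplectic Ω)
    (htame : Tames Ω (complexStructure E M)) {φ : OpenPartialHomeomorph M E} (hφ : φ ∈ atlas E M)
    (hx : x₀ ∈ φ.source) (l m : E →L[ℂ] ℂ) :
    MDifferentiableAt 𝓘(ℂ, E) 𝓘(ℂ, ℂ) (fun x => Qtilde20 Ω x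
        (differential (fun p => l (φ p)) x) (differential (fun p => m (φ p)) x)) x₀ ↔
      ∀ v, torsionForm (formInChart Ω x₀) (endInChart Ω x₀) (mulI E) (extChartAt 𝓘(ℝ, E) x₀ x₀) v
        (hamiltonian Ω x₀ (extChartAt 𝓘(ℝ, E) x₀ x₀)
          (fderiv ℂ (fun e => l (φ ((extChartAt 𝓘(ℝ, E) x₀).symm e))) (extChartAt 𝓘(ℝ, E) x₀ x₀)))
        (hamiltonian Ω x₀ (extChartAt 𝓘(ℝ, E) x₀ x₀)
          (fderiv ℂ (fun e => m (φ ((extChartAt 𝓘(ℝ, E) x₀).symm e)))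
            (extChartAt 𝓘(ℝ, E) x₀ x₀))) = 0 := by
  rw [mdifferentiableAt_iff_chart, ← differentiableAt_poisson_iff hΩ htame
    (differentiableAt_fderiv_coordinate hφ hx l) (differentiableAt_fderiv_coordinate hφ hx m)]
  apply Filter.EventuallyEq.differentiableAt_iff
  have h1 : ∀ᶠ e in 𝓝 (extChartAt 𝓘(ℝ, E) x₀ x₀), (extChartAt 𝓘(ℝ, E) x₀).symm e ∈ φ.source :=
    (continuousAt_extChartAt_symm x₀).preimage_mem_nhds
      (by rw [extChartAt_to_inv]; exact φ.open_source.mem_nhds hx)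
  filter_upwards [h1, extChartAt_target_mem_nhds (I := 𝓘(ℝ, E)) x₀] with e hφe he
  exact Qtilde20_differential hΩ htame he
    ((contMDiffAt_coordinate hφ hφe l).mdifferentiableAt (by simp))
    ((contMDiffAt_coordinate hφ hφe m).mdifferentiableAt (by simp))

/-- To see that the torsion vanishes at `x₀`, the preferred chart there is enough: its coordinate
differentials are the constant functionals, whose Hamiltonian vectors are arbitrary. -/
lemma isHolomorphicBivector_iff (hΩ : IsSymplectic Ω) (htame : Tames Ω (complexStructure E M)) :
    IsHolomorphicBivector (Qtilde20 Ω) ↔ ∀ (x₀ : M) (x y z : E),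
      torsionForm (formInChart Ω x₀) (endInChart Ω x₀) (mulI E)
        (extChartAt 𝓘(ℝ, E) x₀ x₀) x y z = 0 := by
  constructor
  · intro H x₀ x y z
    have hmem := mem_extChartAt_target (I := 𝓘(ℝ, E)) x₀
    obtain ⟨l, rfl⟩ := exists_hamiltonian_eq hΩ hmem y
    obtain ⟨m, rfl⟩ := exists_hamiltonian_eq hΩ hmem z
    have h1 := ((H _ (chart_mem_atlas E x₀) l m) x₀ (mem_chart_source E x₀)).mdifferentiableAt
      ((chartAt E x₀).open_source.mem_nhds (mem_chart_source E x₀))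
    rw [mdifferentiableAt_Qtilde20_iff hΩ htame (chart_mem_atlas E x₀) (mem_chart_source E x₀)]
      at h1
    have h2 : ∀ k : E →L[ℂ] ℂ, fderiv ℂ (fun e => k (chartAt E x₀
        ((extChartAt 𝓘(ℝ, E) x₀).symm e))) (extChartAt 𝓘(ℝ, E) x₀ x₀) = k := by
      intro k
      have h3 : (fun e => k (chartAt E x₀ ((extChartAt 𝓘(ℝ, E) x₀).symm e)))
          =ᶠ[𝓝 (extChartAt 𝓘(ℝ, E) x₀ x₀)] k := by
        filter_upwards [extChartAt_target_mem_nhds (I := 𝓘(ℝ, E)) x₀] with e he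
        exact congrArg k ((extChartAt 𝓘(ℝ, E) x₀).right_inv he)
      rw [h3.fderiv_eq, k.fderiv]
    rw [h2, h2] at h1
    exact h1 x
  · intro H φ hφ l m p hp
    refine MDifferentiableAt.mdifferentiableWithinAt ?_
    exact (mdifferentiableAt_Qtilde20_iff hΩ htame hφ hp l m).2 fun v => H p v _ _

end Holomorphy

end TamedGK

end

theorem theorem4p6 {E M : Type*} [NormedAddCommGroup E] [NormedSpace ℂ E] [FiniteDimensional ℂ E]
    [TopologicalSpace M] [ChartedSpace E M] [IsManifold 𝓘(ℂ, E) ω M]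
    (Ω : TamedGK.BilinField E M) (hΩ : TamedGK.IsSymplectic Ω)
    (htame : TamedGK.Tames Ω (TamedGK.complexStructure E M)) :
    TamedGK.IsHolomorphicBivector (TamedGK.Qtilde20 Ω) ↔
      ∀ U : Set M, IsOpen U → ∀ X Y Z : TamedGK.VField E M,
        TamedGK.SmoothOn X U → TamedGK.SmoothOn Y U → TamedGK.SmoothOn Z U →
          ∀ x ∈ U, TamedGK.psi30 Ω X Y Z x = 0 := by
  rw [TamedGK.isHolomorphicBivector_iff hΩ htame]
  exact ⟨fun H U hU X Y Z _ hY hZ x hx => TamedGK.psi30_eq_zero hΩ htame (H x) hU hx X hY hZ,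
    fun H x₀ => TamedGK.torsionForm_eq_zero_of_psi30 hΩ htame H⟩
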